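/- Let $K$ be a field, let $n\ge 0$, and let $S=K[x_1,\dots,x_n]$ with the standard grading and $\mathfrak m=(x_1,\dots,x_n)$; all modules, ideals and exact sequences are graded, and $M(a)_d=M_{a+d}$. For an integer $t\ge 0$ and a graded $S$-module $N$ of finite length, a graded ideal $I\subset S$ is called a single spot ideal of type $(t,N)$ if $t=\operatorname{depth} S/I<\dim S/I$, $H^t_{\mathfrak m}(S/I)\cong N$ as graded modules, and $H^i_{\mathfrak m}(S/I)=0$ for all $i<\dim S/I$ with $i\neq t$. Let $E_1$ denote the first syzygy module of $K=S/\mathfrak m$ over $S$, that is, the kernel of the augmentation $S\to K$, with its grading as a submodule of $S$. Then for every $c\in\mathbb Z$ there is no single spot ideal $I\subset S$ of codimension $3$ and of type $(0,K(-c))$ that fits into a long Bourbaki sequence with approximation module $E_1$, that is, into an exact sequence of graded $S$-modules and homomorphisms of degree $0$ \[ 0\longrightarrow F\longrightarrow G\longrightarrow E_1\longrightarrow I(c)\longrightarrow 0 \] with $F$ and $G$ graded free $S$-modules of finite rank. -/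

import Mathlib

open MvPolynomial

noncomputable section

namespace SingleSpot

/-! ### Graded modules over `S = K[x_1, …, x_n]`

The grading of an `S`-module `M` is recorded by the family `ℳ : ℤ → AddSubgroup M` of its
homogeneous components. -/

section Graded

variable {K : Type*} [Field K] {n : ℕ}

/-- The standard grading of `S`: the degree `d` component consists of the polynomials all of whose
monomials have total degree `d` (so it is zero for `d < 0`). -/
def polyGrading (K : Type*) [Field K] (n : ℕ) (d : ℤ) : AddSubgroup (MvPolynomial (Fin n) K) where
  carrier := {f | ∀ a : Fin n →₀ ℕ, coeff a f ≠ 0 → (a.degree : ℤ) = d}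
  zero_mem' := by simp
  add_mem' := by
    intro f g hf hg a ha
    by_cases h : coeff a f = 0
    · exact hg a (by simpa [h] using ha)
    · exact hf a h
  neg_mem' := by
    intro f hf a ha
    exact hf a (by simpa using ha)

theorem mem_polyGrading_natCast (f : MvPolynomial (Fin n) K) (k : ℕ) :
    f ∈ polyGrading K n k ↔ f.IsHomogeneous k := by
  constructor
  · intro h a ha
    have := h a ha
    rw [Finsupp.degree_eq_weight_one] at this
    exact_mod_cast this
  · intro h a ha
    have := h ha
    rw [Finsupp.degree_eq_weight_one]
    exact_mod_cast this

/-- The twist `M(a)`, with `M(a)_d = M_{a + d}`. -/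
def twist {M : Type*} [AddCommGroup M] (ℳ : ℤ → AddSubgroup M) (a : ℤ) : ℤ → AddSubgroup M :=
  fun d => ℳ (a + d)

/-- The grading of an ideal `I` of `S`: `I_d = I ∩ S_d`. -/
def idealGrading (I : Ideal (MvPolynomial (Fin n) K)) (d : ℤ) : AddSubgroup I :=
  (polyGrading K n d).comap (Submodule.subtype I).toAddMonoidHom

/-- The grading of `S ⧸ I`: the degree `d` component is the image of `S_d`. -/
def quotientGrading (I : Ideal (MvPolynomial (Fin n) K)) (d : ℤ) :
    AddSubgroup (MvPolynomial (Fin n) K ⧸ I) :=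
  (polyGrading K n d).map (Ideal.Quotient.mk I).toAddMonoidHom

/-- The grading of the graded free module `S(-a_1) ⊕ ⋯ ⊕ S(-a_p)`. -/
def freeGrading (K : Type*) [Field K] (n : ℕ) {p : ℕ} (a : Fin p → ℤ) (d : ℤ) :
    AddSubgroup (Fin p → MvPolynomial (Fin n) K) :=
  AddSubgroup.pi Set.univ fun i => twist (polyGrading K n) (-a i) d

/-- Homomorphisms of degree `0`. -/
def IsGradedHom {M N : Type*} [AddCommGroup M] [AddCommGroup N]
    [Module (MvPolynomial (Fin n) K) M] [Module (MvPolynomial (Fin n) K) N]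
    (ℳ : ℤ → AddSubgroup M) (𝒩 : ℤ → AddSubgroup N)
    (f : M →ₗ[MvPolynomial (Fin n) K] N) : Prop :=
  ∀ d, ∀ x ∈ ℳ d, f x ∈ 𝒩 d

/-- Isomorphism of graded `S`-modules. -/
def GradedIso (K : Type*) [Field K] (n : ℕ) {M N : Type*} [AddCommGroup M] [AddCommGroup N]
    [Module (MvPolynomial (Fin n) K) M] [Module (MvPolynomial (Fin n) K) N]
    (ℳ : ℤ → AddSubgroup M) (𝒩 : ℤ → AddSubgroup N) : Prop :=
  ∃ e : M ≃ₗ[MvPolynomial (Fin n) K] N, ∀ d x, e x ∈ 𝒩 d ↔ x ∈ ℳ d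

/-- The graded maximal ideal `𝔪 = (x_1, …, x_n)`. -/
def maxIdeal (K : Type*) [Field K] (n : ℕ) : Ideal (MvPolynomial (Fin n) K) :=
  Ideal.span (Set.range X)

/-- The first syzygy module `E_1` of `K = S ⧸ 𝔪`: the kernel of the augmentation `S → K`, which
is the start of the minimal graded free resolution of `K`. It is graded by `idealGrading`. -/
def firstSyzygy (K : Type*) [Field K] (n : ℕ) : Ideal (MvPolynomial (Fin n) K) :=
  RingHom.ker (constantCoeff : MvPolynomial (Fin n) K →+* K)

/-- The graded module `K(a)`, where `K = S ⧸ 𝔪` sits in degree `0`. -/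
def residueTwist (K : Type*) [Field K] (n : ℕ) (a : ℤ) :
    ℤ → AddSubgroup (MvPolynomial (Fin n) K ⧸ maxIdeal K n) :=
  twist (quotientGrading (maxIdeal K n)) a

end Graded

/-! ### Graded local cohomology with support in `𝔪`

Mathlib's local cohomology modules carry no grading, so the graded local cohomology modules
`H^k_𝔪(M)` are constructed as the cohomology of the Čech complex of `M` with respect to
`x_1, …, x_n`. -/

section Cech

variable {K : Type*} [Field K] {n : ℕ}

/-- The multiplicative set generated by the variables `x_i`, `i ∈ s`. -/
def varMonoid (K : Type*) [Field K] {n : ℕ} (s : Finset (Fin n)) :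
    Submonoid (MvPolynomial (Fin n) K) :=
  Submonoid.closure ((X : Fin n → MvPolynomial (Fin n) K) '' (s : Set (Fin n)))

theorem varMonoid_mono {s t : Finset (Fin n)} (h : s ⊆ t) : varMonoid K s ≤ varMonoid K t :=
  Submonoid.closure_mono (Set.image_mono (by exact_mod_cast h))

variable (K n) (M : Type*) [AddCommGroup M] [Module (MvPolynomial (Fin n) K) M]

/-- The Čech module `C^k(M) = ⨁_{|s| = k} M_{x_s}`, where `M_{x_s}` is the localization of `M` at
the product of the `x_i`, `i ∈ s`. -/
abbrev CechModule (k : ℕ) : Type _ :=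
  (s : {s : Finset (Fin n) // s.card = k}) → LocalizedModule (varMonoid K s.1) M

/-- The set `t` without its element `j`. -/
def eraseIndex {n k : ℕ} (t : {s : Finset (Fin n) // s.card = k + 1}) (j : t.1) :
    {s : Finset (Fin n) // s.card = k} :=
  ⟨t.1.erase j.1, by simp [Finset.card_erase_of_mem j.2, t.2]⟩

/-- The Čech differential `C^k(M) → C^{k+1}(M)`: its component at `t` is the sum over `j ∈ t` of
`(-1)^#{i ∈ t | i < j}` times the localization map `M_{x_{t ∖ j}} → M_{x_t}`. -/
def cechDifferential (k : ℕ) :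
    CechModule K n M k →ₗ[MvPolynomial (Fin n) K] CechModule K n M (k + 1) :=
  LinearMap.pi fun t => ∑ j : t.1,
    ((-1 : MvPolynomial (Fin n) K) ^ (t.1.filter (· < j.1)).card) •
      (LocalizedModule.liftOfLE (M := M) (varMonoid K (eraseIndex t j).1) (varMonoid K t.1)
        (varMonoid_mono (Finset.erase_subset _ _))).comp (LinearMap.proj (eraseIndex t j))

/-- The coboundaries in `C^k(M)` (zero for `k = 0`). -/
def cechBoundaries : (k : ℕ) → Submodule (MvPolynomial (Fin n) K) (CechModule K n M k)
  | 0 => ⊥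
  | k + 1 => LinearMap.range (cechDifferential K n M k)

/-- The local cohomology module `H^k_𝔪(M)`: Čech cocycles modulo Čech coboundaries. -/
abbrev LocalCohomology (k : ℕ) : Type _ :=
  LinearMap.ker (cechDifferential K n M k) ⧸
    (cechBoundaries K n M k).comap (LinearMap.ker (cechDifferential K n M k)).subtype

variable {M} (ℳ : ℤ → AddSubgroup M)

/-- The grading of the localization `M_{x_s}`: the degree `d` component consists of the fractions
`m / u` with `u` homogeneous of some degree `e` and `m` homogeneous of degree `d + e`. -/
def locGrading (s : Finset (Fin n)) (d : ℤ) :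
    AddSubgroup (LocalizedModule (varMonoid K s) M) :=
  AddSubgroup.closure {y | ∃ (e : ℕ) (u : varMonoid K s) (m : M),
    u.1.IsHomogeneous e ∧ m ∈ ℳ (d + e) ∧ y = LocalizedModule.mk m u}

/-- The grading of `H^k_𝔪(M)`: the degree `d` component consists of the classes of the cocycles
all of whose components are homogeneous of degree `d`. -/
def localCohomologyGrading (k : ℕ) (d : ℤ) : AddSubgroup (LocalCohomology K n M k) :=
  ((AddSubgroup.pi Set.univ fun s : {s : Finset (Fin n) // s.card = k} =>
      locGrading K n ℳ s.1 d).comap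
    (LinearMap.ker (cechDifferential K n M k)).subtype.toAddMonoidHom).map
    (Submodule.mkQ ((cechBoundaries K n M k).comap
      (LinearMap.ker (cechDifferential K n M k)).subtype)).toAddMonoidHom

end Cech

/-! ### Single spot ideals and long Bourbaki sequences -/

section Main

attribute [local instance] MvPolynomial.gradedAlgebra

variable {K : Type*} [Field K] {n : ℕ}

/-- The depth of a graded `S`-module: the supremum of the lengths of the `M`-regular sequences
in `𝔪`. -/
def depth (K : Type*) [Field K] (n : ℕ) (M : Type*) [AddCommGroup M]
    [Module (MvPolynomial (Fin n) K) M] : ℕ∞ :=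
  ⨆ rs : {rs : List (MvPolynomial (Fin n) K) //
    (∀ r ∈ rs, r ∈ maxIdeal K n) ∧ RingTheory.Sequence.IsRegular M rs}, (rs.1.length : ℕ∞)

/-- `I` is a single spot ideal of type `(t, N)`: a graded ideal such that `t = depth S/I`, `N` is a
graded module of finite length, and among the local cohomology modules `H^i_𝔪(S/I)` with
`i < dim S/I` the only one that does not vanish is the one at the spot `i = t < dim S/I`, where it
is `N`. -/
structure IsSingleSpotIdeal (I : Ideal (MvPolynomial (Fin n) K)) (t : ℕ)
    {N : Type*} [AddCommGroup N] [Module (MvPolynomial (Fin n) K) N]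
    (𝒩 : ℤ → AddSubgroup N) : Prop where
  homogeneous : I.IsHomogeneous (homogeneousSubmodule (Fin n) K)
  finite_length : IsFiniteLength (MvPolynomial (Fin n) K) N
  depth_eq : depth K n (MvPolynomial (Fin n) K ⧸ I) = t
  lt_dim : (t : WithBot ℕ∞) < ringKrullDim (MvPolynomial (Fin n) K ⧸ I)
  vanishing : ∀ i : ℕ, (i : WithBot ℕ∞) < ringKrullDim (MvPolynomial (Fin n) K ⧸ I) → i ≠ t →
    Subsingleton (LocalCohomology K n (MvPolynomial (Fin n) K ⧸ I) i)
  spot : GradedIso K n (localCohomologyGrading K n (quotientGrading I) t) 𝒩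

/-- There are graded free modules `F = ⨁ S(-a_i)` and `G = ⨁ S(-b_i)` of finite rank and an exact
sequence `0 → F → G → M → I(c) → 0` with homomorphisms of degree `0`; that is, `I` fits into a long
Bourbaki sequence (of length appropriate to codimension three) with approximation module `M`. -/
def HasLongBourbakiSequence {M : Type*} [AddCommGroup M] [Module (MvPolynomial (Fin n) K) M]
    (ℳ : ℤ → AddSubgroup M) (I : Ideal (MvPolynomial (Fin n) K)) (c : ℤ) : Prop :=
  ∃ (p q : ℕ) (a : Fin p → ℤ) (b : Fin q → ℤ)
    (f : (Fin p → MvPolynomial (Fin n) K) →ₗ[MvPolynomial (Fin n) K]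
      (Fin q → MvPolynomial (Fin n) K))
    (g : (Fin q → MvPolynomial (Fin n) K) →ₗ[MvPolynomial (Fin n) K] M)
    (φ : M →ₗ[MvPolynomial (Fin n) K] I),
    IsGradedHom (freeGrading K n a) (freeGrading K n b) f ∧
    IsGradedHom (freeGrading K n b) ℳ g ∧
    IsGradedHom ℳ (twist (idealGrading I) c) φ ∧
    Function.Injective f ∧ Function.Exact f g ∧ Function.Exact g φ ∧ Function.Surjective φ

end Main

end SingleSpot

end

/-! The obstruction lies in the last map `E_1 → I(c)`. As `E_1` contains two non-associate primes `X
i`, `X j`, any linear map from it to an ideal is multiplication by some `h ∈ S`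
(`LinearMap.exists_eq_mul_of_not_dvd`). Surjectivity gives `I = h E_1`. Were `h` not a unit, `I ⊆
(h)` would have height at most one by Krull; so `I = E_1` is maximal, `dim S/I = 0`, and the spot `t
= 0` violates `t < dim S/I`. -/

theorem LinearMap.exists_eq_mul_of_not_dvd {R : Type*} [CommRing R] [IsDomain R] {J I : Ideal R}
    (φ : J →ₗ[R] I) {x y : R} (hx : x ∈ J) (hy : y ∈ J) (hp : Prime x) (hxy : ¬ x ∣ y) :
    ∃ h : R, ∀ z : J, (φ z : R) = h * z := by
  -- Both sides are `φ (z * w)`, so the ratio `φ z / z` is constant on nonzero `z`.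
  have key : ∀ z w : J, (z : R) * φ w = w * φ z := fun z w => by
    have h : (z : R) • w = (w : R) • z := Subtype.ext (mul_comm _ _)
    simpa using congrArg (fun u => (φ u : R)) h
  -- The ratio has no denominator: `x` divides `y * φ x = x * φ y` but not `y`. Thus `h = φ x / x`.
  obtain ⟨h, hh⟩ : x ∣ φ ⟨x, hx⟩ :=
    (hp.dvd_or_dvd ⟨φ ⟨y, hy⟩, (key ⟨x, hx⟩ ⟨y, hy⟩).symm⟩).resolve_left hxy
  refine ⟨h, fun z => mul_left_cancel₀ hp.ne_zero ?_⟩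
  rw [key ⟨x, hx⟩ z, hh]
  ring

theorem Ideal.height_le_one_of_le_span_singleton {R : Type*} [CommRing R] [IsNoetherianRing R]
    {I : Ideal R} {x : R} (hI : I ≤ Ideal.span {x}) (hx : ¬ IsUnit x) : I.height ≤ 1 :=
  (Ideal.height_mono hI).trans (Ideal.height_span_singleton_le_one hx)

theorem Ideal.height_ne_three_of_isPrincipal {R : Type*} [CommRing R] [IsNoetherianRing R]
    (I : Ideal R) [I.IsPrincipal] : I.height ≠ 3 := by
  intro h3
  by_cases hu : IsUnit (Submodule.IsPrincipal.generator I)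
  -- The unit ideal has height `⊤` by convention, so it needs its own case.
  · rw [Ideal.eq_top_of_isUnit_mem I (Submodule.IsPrincipal.generator_mem I) hu,
      Ideal.height_top] at h3
    exact absurd h3 (by decide)
  · have h1 := Ideal.height_le_one_of_le_span_singleton (Ideal.span_singleton_generator I).ge hu
    rw [h3] at h1
    exact absurd h1 (by decide)

theorem MvPolynomial.isPrincipalIdealRing_fin_of_le_one (K : Type*) [Field K] {n : ℕ}
    (hn : n ≤ 1) : IsPrincipalIdealRing (MvPolynomial (Fin n) K) := by
  obtain rfl | rfl : n = 0 ∨ n = 1 := by omega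
  · exact .of_surjective _ (isEmptyRingEquiv K (Fin 0)).symm.surjective
  · exact .of_surjective _ (uniqueAlgEquiv K (Fin 1)).symm.surjective

namespace SingleSpot

theorem isMaximal_firstSyzygy (K : Type*) [Field K] (n : ℕ) : (firstSyzygy K n).IsMaximal :=
  RingHom.ker_isMaximal_of_surjective _ fun a => ⟨C a, constantCoeff_C _ a⟩

theorem X_mem_firstSyzygy (K : Type*) [Field K] {n : ℕ} (i : Fin n) : X i ∈ firstSyzygy K n :=
  constantCoeff_X K i

/-- An ideal of height three that is a homomorphic image of `E_1` is equal to `E_1`. -/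
theorem eq_firstSyzygy_of_surjective {K : Type*} [Field K] {n : ℕ}
    {I : Ideal (MvPolynomial (Fin n) K)} (h3 : I.height = 3)
    (φ : firstSyzygy K n →ₗ[MvPolynomial (Fin n) K] I) (hφ : Function.Surjective φ) :
    I = firstSyzygy K n := by
  -- Two distinct variables are needed; with fewer, `S` is a principal ideal ring, where height
  -- three cannot occur.
  have hn : 2 ≤ n := by
    by_contra! hn
    have := isPrincipalIdealRing_fin_of_le_one K (Nat.le_of_lt_succ hn)
    exact I.height_ne_three_of_isPrincipal h3
  let i : Fin n := ⟨0, by omega⟩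
  let j : Fin n := ⟨1, by omega⟩
  have hij : ¬ (X i : MvPolynomial (Fin n) K) ∣ X j := by simp [X_dvd_X, i, j]
  obtain ⟨h, hh⟩ := LinearMap.exists_eq_mul_of_not_dvd φ (X_mem_firstSyzygy K i)
    (X_mem_firstSyzygy K j) X_prime hij
  have hu : IsUnit h := by
    by_contra hu
    have h1 : I.height ≤ 1 := Ideal.height_le_one_of_le_span_singleton (fun z hz => by
      obtain ⟨w, hw⟩ := hφ ⟨z, hz⟩
      exact Ideal.mem_span_singleton.2 ⟨w, by rw [← hh w, hw]⟩) hu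
    rw [h3] at h1
    exact absurd h1 (by decide)
  refine le_antisymm (fun z hz => ?_) fun z hz => ?_
  · obtain ⟨w, hw⟩ := hφ ⟨z, hz⟩
    have hz' : z = h * w := by rw [← hh w, hw]
    exact hz' ▸ Ideal.mul_mem_left _ h w.2
  · have := (φ ⟨z, hz⟩).2
    rw [hh] at this
    exact (Ideal.unit_mul_mem_iff_mem I hu).1 this

end SingleSpot

theorem corollary2p4 {K : Type*} [Field K] (n : ℕ) (c : ℤ) :
    ¬ ∃ I : Ideal (MvPolynomial (Fin n) K),
      I.height = 3 ∧
      SingleSpot.IsSingleSpotIdeal I 0 (SingleSpot.residueTwist K n (-c)) ∧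
      SingleSpot.HasLongBourbakiSequence
        (SingleSpot.idealGrading (SingleSpot.firstSyzygy K n)) I c := by
  rintro ⟨I, h3, hI, p, q, a, b, f, g, φ, -, -, -, -, -, -, hφ⟩
  have hdim := hI.lt_dim
  obtain rfl := SingleSpot.eq_firstSyzygy_of_surjective h3 φ hφ
  have := SingleSpot.isMaximal_firstSyzygy K n
  -- `S/E_1` is a field, so `hdim` becomes `0 < 0`.
  rw [ringKrullDim_eq_zero_of_isField ((Ideal.Quotient.maximal_ideal_iff_isField_quotient _).1 this)]
    at hdim
  exact absurd hdim (by simp)
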